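/- Let $\ell, m, n$ be positive integers, let $\|\cdot\|$ be a norm on $\mathbb{R}^m$, and let $X$ be uniformly distributed in $\{\pm1\}^n$. For $S \subseteq [n]$ put $\chi_S(x) = \prod_{j\in S} x_j$. Every $f : \{\pm 1\}^n \to \mathbb{R}^m$ has a unique expansion $f(x) = \sum_{S \subseteq [n]} \hat f(S)\,\chi_S(x)$ with $\hat f(S) \in \mathbb{R}^m$ (namely $\hat f(S) = \mathbb{E}[\chi_S(X) f(X)]$); let $f_\ell(x) = \sum_{S \subseteq [n],\, |S| = \ell} \hat f(S)\,\chi_S(x)$ be its $\ell$-th homogeneous part. Then for every function $f : \{\pm 1\}^n \to \mathbb{R}^m$, $$\bigl(\mathbb{E}\,\|f_\ell(X)\|^2\bigr)^{1/2} \le \Bigl(4 + \frac{6 \log(m+1)}{\ell}\Bigr)^{\ell} \cdot \bigl(\mathbb{E}\,\|f(X)\|^2\bigr)^{1/2},$$ where $\log$ is the natural logarithm. -/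

import Mathlib

open scoped BigOperators

noncomputable section

/-- The discrete cube `{±1}^n`; the units of `ℤ` are exactly `1` and `-1`. -/
abbrev Cube (n : ℕ) : Type := Fin n → ℤˣ

/-- The character `χ_S(x) = ∏_{j ∈ S} x_j`. -/
def chi {n : ℕ} (S : Finset (Fin n)) (x : Cube n) : ℝ :=
  ∏ j ∈ S, ((x j : ℤ) : ℝ)

/-- The Fourier coefficient `f̂(S) = 𝔼 χ_S(X) f(X) ∈ ℝ^m`. That these are the unique coefficients
of `f` in the characters is `sum_cubeCoeff` and `cubeCoeff_unique`. -/
def cubeCoeff {n m : ℕ} (f : Cube n → (Fin m → ℝ)) (S : Finset (Fin n)) : Fin m → ℝ :=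
  𝔼 x : Cube n, chi S x • f x

/-- The `ℓ`-th homogeneous part `f_ℓ(x) = ∑_{|S| = ℓ} f̂(S) χ_S(x)`. -/
def levelPart {n m : ℕ} (ℓ : ℕ) (f : Cube n → (Fin m → ℝ)) (x : Cube n) : Fin m → ℝ :=
  ∑ S : Finset (Fin n) with S.card = ℓ, chi S x • cubeCoeff f S

/-- `(𝔼 ‖f(X)‖²)^{1/2}` for `X` uniform on the cube and the norm `N` on `ℝ^m`. -/
def l2Norm {n m : ℕ} (N : Seminorm ℝ (Fin m → ℝ)) (f : Cube n → (Fin m → ℝ)) : ℝ :=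
  Real.sqrt (𝔼 x : Cube n, N (f x) ^ 2)

theorem sum_chi_mul_chi {n : ℕ} (x y : Cube n) :
    ∑ S : Finset (Fin n), chi S x * chi S y = if x = y then (2 : ℝ) ^ n else 0 := by
  have h : ∑ S : Finset (Fin n), chi S x * chi S y
      = ∏ j : Fin n, (1 + ((x j : ℤ) : ℝ) * ((y j : ℤ) : ℝ)) := by
    rw [Finset.prod_one_add, Finset.powerset_univ]
    exact Finset.sum_congr rfl fun S _ => by simp [chi, Finset.prod_mul_distrib]
  rw [h]
  split_ifs with hxy
  · subst hxy
    have : ∀ j, (1 + ((x j : ℤ) : ℝ) * ((x j : ℤ) : ℝ)) = 2 := fun j => by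
      rcases Int.units_eq_one_or (x j) with h | h <;> simp [h] <;> norm_num
    simp [this]
  · obtain ⟨j, hj⟩ := Function.ne_iff.mp hxy
    refine Finset.prod_eq_zero (Finset.mem_univ j) ?_
    rcases Int.units_eq_one_or (x j) with h | h <;>
      rcases Int.units_eq_one_or (y j) with h' | h' <;> simp_all

/-- The Fourier expansion `f(x) = ∑_S f̂(S) χ_S(x)`. -/
theorem sum_cubeCoeff {n m : ℕ} (f : Cube n → (Fin m → ℝ)) (x : Cube n) :
    ∑ S : Finset (Fin n), chi S x • cubeCoeff f S = f x := by
  ext i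
  simp only [cubeCoeff, Finset.sum_apply, Pi.smul_apply, smul_eq_mul, Finset.expect_apply,
    Fintype.expect_eq_sum_div_card, ← mul_div_assoc, Finset.mul_sum]
  rw [← Finset.sum_div, Finset.sum_comm]
  have : ∀ y : Cube n, ∑ S : Finset (Fin n), chi S x * (chi S y * f y i)
      = if x = y then (2 : ℝ) ^ n * f y i else 0 := fun y => by
    simp_rw [← mul_assoc, ← Finset.sum_mul, sum_chi_mul_chi]
    split_ifs <;> simp
  simp [this]

theorem expect_chi_mul_chi {n : ℕ} (S T : Finset (Fin n)) :
    𝔼 x : Cube n, chi S x * chi T x = if S = T then (1 : ℝ) else 0 := by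
  split_ifs with h
  · subst h
    have : ∀ x : Cube n, chi S x * chi S x = 1 := fun x => by
      rw [chi, ← Finset.prod_mul_distrib]
      refine Finset.prod_eq_one fun j _ => ?_
      rcases Int.units_eq_one_or (x j) with h | h <;> simp [h]
    simp [this]
  · obtain ⟨j, hj⟩ : ∃ j, ¬ (j ∈ S ↔ j ∈ T) := by
      by_contra hc
      push Not at hc
      exact h (Finset.ext hc)
    have e : ∀ x : Cube n, chi S x * chi T x
        = ∏ i, ((if i ∈ S then ((x i : ℤ) : ℝ) else 1) * (if i ∈ T then ((x i : ℤ) : ℝ) else 1)) :=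
      fun x => by rw [Finset.prod_mul_distrib]; simp [chi]
    rw [Fintype.expect_eq_sum_div_card]
    simp_rw [e]
    rw [← Fintype.prod_sum (fun i (u : ℤˣ) =>
      (if i ∈ S then ((u : ℤ) : ℝ) else 1) * (if i ∈ T then ((u : ℤ) : ℝ) else 1))]
    rw [Finset.prod_eq_zero (Finset.mem_univ j), zero_div]
    have hu : (Finset.univ : Finset ℤˣ) = {1, -1} := by decide
    rw [hu, Finset.sum_pair (by decide)]
    by_cases hS : j ∈ S <;> by_cases hT : j ∈ T <;> simp_all

/-- Uniqueness of the Fourier expansion. -/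
theorem cubeCoeff_unique {n m : ℕ} (f : Cube n → (Fin m → ℝ))
    (c : Finset (Fin n) → (Fin m → ℝ))
    (h : ∀ x, f x = ∑ S : Finset (Fin n), chi S x • c S) : c = cubeCoeff f := by
  ext T i
  have : ∀ x : Cube n, chi T x * f x i
      = ∑ S : Finset (Fin n), (chi T x * chi S x) * c S i := fun x => by
    rw [h x]
    simp [Finset.mul_sum, mul_assoc]
  simp only [cubeCoeff, Finset.expect_apply, Pi.smul_apply, smul_eq_mul, this]
  rw [Finset.expect_sum_comm]
  simp_rw [← Finset.expect_mul, expect_chi_mul_chi]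
  simp

end

/-! Choose a linear functional `φ` dominated by the `L²` norm and norming `f_ℓ`. Then `p(z) = ∑
φ(f_k) z^k` has the quantity to be bounded as its `ℓ`-th coefficient. With `C` the `L²` norm of `f`,
two estimates hold. On `[-1, 1]`, `p(x)` is `φ` of the noise operator applied to `f`, and noise is a
contraction, so `|p| ≤ C`. On the unit disc, `|p| ≤ ∑ |φ(f_k)| ≤ m C`: multiplying levels by signs
costs at most a factor `m`, by Parseval in each coordinate of an Auerbach basis. The three lines
theorem for `p(sin w / cosh 1)` interpolates these to `C m^(im w)` on `0 ≤ im w ≤ 1`. Cauchy's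
estimate on the circle of radius `y / cosh 1` then bounds the coefficient by `C m^y (cosh 1 / y)^ℓ`,
and `y` is optimised. -/

/-! ### Complex analysis: interpolation in a strip and Cauchy's estimate -/

theorem Complex.sq_norm_sin (w : ℂ) :
    ‖Complex.sin w‖ ^ 2 = Real.sin w.re ^ 2 + Real.sinh w.im ^ 2 := by
  rw [Complex.sin_eq, ← Complex.ofReal_sin, ← Complex.ofReal_cos, ← Complex.ofReal_sinh,
    ← Complex.ofReal_cosh, ← Complex.ofReal_mul, ← Complex.ofReal_mul, Complex.sq_norm,
    Complex.normSq_add_mul_I]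
  have h1 := Real.cosh_sq w.im
  have h2 := Real.cos_sq' w.re
  rw [mul_pow, mul_pow, h1, h2]
  ring

theorem Complex.norm_sin_le_cosh (w : ℂ) : ‖Complex.sin w‖ ≤ Real.cosh w.im := by
  refine le_of_sq_le_sq ?_ (Real.cosh_pos _).le
  rw [Complex.sq_norm_sin, Real.cosh_sq]
  linarith [Real.sin_sq_le_one w.re]

/-- Keeps preimages under sine of a circle of radius `y` at height at most `y`, inside the strip. -/
theorem Complex.abs_im_le_norm_sin (w : ℂ) : |w.im| ≤ ‖Complex.sin w‖ := by
  refine le_of_sq_le_sq ?_ (norm_nonneg _)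
  rw [Complex.sq_norm_sin, sq_abs]
  have h : w.im ^ 2 ≤ Real.sinh w.im ^ 2 := by
    rw [sq_le_sq, Real.abs_sinh]
    exact Real.self_le_sinh_iff.2 (abs_nonneg _)
  linarith [sq_nonneg (Real.sin w.re)]

/-- A polynomial bounded by `C` on `[-1, 1]` and by `D * C` on the unit disc, pulled back along
`w ↦ sin w / cosh 1`, grows at most like `D ^ (im w)` in the strip `0 ≤ im w ≤ 1`. -/
theorem norm_eval_sin_div_cosh_le {p : Polynomial ℂ} {C D : ℝ} (hD : 0 < D)
    (hreal : ∀ x : ℝ, |x| ≤ 1 → ‖p.eval (x : ℂ)‖ ≤ C)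
    (hdisc : ∀ z : ℂ, ‖z‖ ≤ 1 → ‖p.eval z‖ ≤ D * C) {w : ℂ} (h0 : 0 ≤ w.im) (h1 : w.im ≤ 1) :
    ‖p.eval (Complex.sin w / (Real.cosh 1 : ℝ))‖ ≤ C * Real.exp (w.im * Real.log D) := by
  -- The exponential factor has modulus `D ^ (-im w)`, so both edges of the strip carry the same
  -- bound `C`.
  set F : ℂ → ℂ := fun w => p.eval (Complex.sin w / (Real.cosh 1 : ℝ)) *
    Complex.exp (Complex.I * w * (Real.log D : ℝ)) with hF
  have hexp : ∀ w : ℂ, ‖Complex.exp (Complex.I * w * (Real.log D : ℝ))‖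
      = Real.exp (-(w.im * Real.log D)) := fun w => by
    rw [Complex.norm_exp]; simp
  have hc : 1 ≤ Real.cosh 1 := Real.one_le_cosh 1
  have hcpos : 0 < Real.cosh 1 := Real.cosh_pos 1
  have hnorm : ∀ w : ℂ, ‖Complex.sin w / (Real.cosh 1 : ℝ)‖ = ‖Complex.sin w‖ / Real.cosh 1 :=
    fun w => by rw [norm_div, Complex.norm_real, Real.norm_of_nonneg hcpos.le]
  have hstrip : ∀ w : ℂ, 0 ≤ w.im → w.im ≤ 1 → ‖Complex.sin w / (Real.cosh 1 : ℝ)‖ ≤ 1 := by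
    intro w h0 h1
    rw [hnorm, div_le_one hcpos]
    refine (Complex.norm_sin_le_cosh w).trans (Real.cosh_le_cosh.2 ?_)
    rwa [abs_of_nonneg h0, abs_one]
  have hd : Differentiable ℂ F := by
    refine Differentiable.mul (p.differentiable.comp ?_) ?_
    · exact Complex.differentiable_sin.div_const _
    · fun_prop
  have hFw : ‖F w‖ ≤ C := by
    refine PhragmenLindelof.horizontal_strip (a := 0) (b := 1) hd.diffContOnCl ?_ ?_ ?_ h0 h1
    -- `F` is bounded on the strip, so the growth condition holds with zero exponents.
    · refine ⟨0, by simpa using Real.pi_pos, 0, ?_⟩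
      refine Asymptotics.IsBigO.of_bound (D * C * Real.exp |Real.log D|) ?_
      refine Filter.eventually_inf_principal.2 (Filter.Eventually.of_forall fun z hz => ?_)
      have hz : 0 < z.im ∧ z.im < 1 := hz
      have hb := hdisc _ (hstrip z hz.1.le hz.2.le)
      simp only [zero_mul, Real.exp_zero, norm_one, mul_one, hF, norm_mul, hexp]
      refine mul_le_mul hb (Real.exp_le_exp.2 ?_) (Real.exp_nonneg _) ((norm_nonneg _).trans hb)
      calc -(z.im * Real.log D) ≤ |z.im * Real.log D| := neg_le_abs _
        _ = |z.im| * |Real.log D| := abs_mul _ _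
        _ ≤ 1 * |Real.log D| := by
          gcongr; rw [abs_of_pos hz.1]; exact hz.2.le
        _ = |Real.log D| := one_mul _
    · intro z hz
      have hz' : z = (z.re : ℂ) := Complex.ext rfl (by simpa using hz)
      have he : Complex.sin z / (Real.cosh 1 : ℝ) = ((Real.sin z.re / Real.cosh 1 : ℝ) : ℂ) := by
        rw [hz']; push_cast; simp
      simp only [hF, norm_mul, hexp, hz, zero_mul, neg_zero, Real.exp_zero, mul_one]
      rw [he]
      refine hreal _ ?_
      rw [abs_div, abs_of_pos hcpos, div_le_one hcpos]
      exact (Real.abs_sin_le_one _).trans hc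
    · intro z hz
      simp only [hF, norm_mul, hexp, hz, one_mul, Real.exp_neg, Real.exp_log hD]
      have := hdisc _ (hstrip z (by simp [hz]) hz.le)
      rw [← div_eq_mul_inv, div_le_iff₀ hD]
      linarith
  simp only [hF, norm_mul, hexp, Real.exp_neg] at hFw
  rwa [← div_eq_mul_inv, div_le_iff₀ (Real.exp_pos _)] at hFw

theorem Polynomial.iteratedDeriv_eval_zero (p : Polynomial ℂ) (k : ℕ) :
    iteratedDeriv k (fun z => p.eval z) 0 = k.factorial * p.coeff k := by
  have h : ∀ k, iteratedDeriv k (fun z => p.eval z)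
      = fun z => (Polynomial.derivative^[k] p).eval z := by
    intro k
    induction k with
    | zero => simp
    | succ k ih =>
      rw [iteratedDeriv_succ, ih, Function.iterate_succ_apply']
      ext z
      exact Polynomial.deriv _
  rw [h]
  beta_reduce
  rw [← Polynomial.coeff_zero_eq_eval_zero, Polynomial.coeff_iterate_derivative]
  simp [Nat.descFactorial_self]

/-- Coefficient bound for a polynomial that is bounded by `C` on `[-1, 1]` and by `D * C` on the
unit disc. -/
theorem norm_coeff_le_of_bounded {p : Polynomial ℂ} {C D : ℝ} (hD : 1 ≤ D) (hC : 0 ≤ C)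
    (hreal : ∀ x : ℝ, |x| ≤ 1 → ‖p.eval (x : ℂ)‖ ≤ C)
    (hdisc : ∀ z : ℂ, ‖z‖ ≤ 1 → ‖p.eval z‖ ≤ D * C) {y : ℝ} (hy0 : 0 < y) (hy1 : y ≤ 1) (k : ℕ) :
    ‖p.coeff k‖ ≤ C * Real.exp (y * Real.log D) / (y / Real.cosh 1) ^ k := by
  have hcpos : 0 < Real.cosh 1 := Real.cosh_pos 1
  have hcne : ((Real.cosh 1 : ℝ) : ℂ) ≠ 0 := by exact_mod_cast hcpos.ne'
  have hR : 0 < y / Real.cosh 1 := by positivity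
  have hb : ∀ z ∈ Metric.sphere (0 : ℂ) (y / Real.cosh 1),
      ‖p.eval z‖ ≤ C * Real.exp (y * Real.log D) := by
    intro z hz
    rw [mem_sphere_zero_iff_norm] at hz
    -- The reflection `w ↦ π - w` preserves sine and flips the sign of `im w`.
    obtain ⟨w, hw, hw0⟩ : ∃ w, Complex.sin w = z * (Real.cosh 1 : ℝ) ∧ 0 ≤ w.im := by
      obtain ⟨w, hw⟩ := Complex.sin_surjective (z * (Real.cosh 1 : ℝ))
      rcases le_total 0 w.im with h | h
      · exact ⟨w, hw, h⟩
      · exact ⟨Real.pi - w, by rw [Complex.sin_pi_sub, hw], by simpa using h⟩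
    have hwy : w.im ≤ y := by
      have := Complex.abs_im_le_norm_sin w
      rw [hw, norm_mul, hz, Complex.norm_real, Real.norm_of_nonneg hcpos.le,
        div_mul_cancel₀ _ hcpos.ne'] at this
      exact (le_abs_self _).trans this
    have hzw : z = Complex.sin w / (Real.cosh 1 : ℝ) := by rw [hw, mul_div_cancel_right₀ _ hcne]
    rw [hzw]
    refine (norm_eval_sin_div_cosh_le (by linarith) hreal hdisc hw0 (hwy.trans hy1)).trans ?_
    have := Real.log_nonneg hD
    gcongr
  have h := Complex.norm_iteratedDeriv_le_of_forall_mem_sphere_norm_le k hR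
    p.differentiable.diffContOnCl hb
  rw [Polynomial.iteratedDeriv_eval_zero, norm_mul, Complex.norm_natCast, mul_div_assoc] at h
  exact le_of_mul_le_mul_left h (by positivity)

/-! ### The `L²` seminorm and norming functionals -/

theorem l2Norm_nonneg {n m : ℕ} (N : Seminorm ℝ (Fin m → ℝ)) (f : Cube n → (Fin m → ℝ)) :
    0 ≤ l2Norm N f := Real.sqrt_nonneg _

theorem sq_l2Norm {n m : ℕ} (N : Seminorm ℝ (Fin m → ℝ)) (f : Cube n → (Fin m → ℝ)) :
    l2Norm N f ^ 2 = 𝔼 x : Cube n, N (f x) ^ 2 :=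
  Real.sq_sqrt (Finset.expect_nonneg fun _ _ => sq_nonneg _)

theorem l2Norm_add_le {n m : ℕ} (N : Seminorm ℝ (Fin m → ℝ)) (f g : Cube n → (Fin m → ℝ)) :
    l2Norm N (f + g) ≤ l2Norm N f + l2Norm N g := by
  have hf := l2Norm_nonneg N f
  have hg := l2Norm_nonneg N g
  refine le_of_sq_le_sq ?_ (add_nonneg hf hg)
  have hcs : 𝔼 x : Cube n, N (f x) * N (g x) ≤ l2Norm N f * l2Norm N g := by
    refine le_of_sq_le_sq ?_ (mul_nonneg hf hg)
    rw [mul_pow, sq_l2Norm, sq_l2Norm]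
    exact Finset.expect_mul_sq_le_sq_mul_sq _ _ _
  calc l2Norm N (f + g) ^ 2 = 𝔼 x : Cube n, N (f x + g x) ^ 2 := sq_l2Norm N _
    _ ≤ 𝔼 x : Cube n, (N (f x) ^ 2 + 2 * (N (f x) * N (g x)) + N (g x) ^ 2) := by
      refine Finset.expect_le_expect fun x _ => ?_
      calc N (f x + g x) ^ 2 ≤ (N (f x) + N (g x)) ^ 2 :=
            pow_le_pow_left₀ (apply_nonneg N _) (map_add_le_add N _ _) 2
        _ = _ := by ring
    _ = l2Norm N f ^ 2 + 2 * (𝔼 x : Cube n, N (f x) * N (g x)) + l2Norm N g ^ 2 := by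
      rw [Finset.expect_add_distrib, Finset.expect_add_distrib, ← Finset.mul_expect, sq_l2Norm,
        sq_l2Norm]
    _ ≤ (l2Norm N f + l2Norm N g) ^ 2 := by nlinarith

theorem l2Norm_smul {n m : ℕ} (N : Seminorm ℝ (Fin m → ℝ)) (c : ℝ) (f : Cube n → (Fin m → ℝ)) :
    l2Norm N (c • f) = |c| * l2Norm N f := by
  have : ∀ x, N ((c • f) x) ^ 2 = c ^ 2 * N (f x) ^ 2 := fun x => by
    rw [Pi.smul_apply, map_smul_eq_mul, mul_pow, Real.norm_eq_abs, sq_abs]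
  rw [l2Norm, l2Norm]
  simp_rw [this]
  rw [← Finset.mul_expect, Real.sqrt_mul (sq_nonneg c), Real.sqrt_sq_eq_abs]

/-- The `L²` norm on vector-valued functions on the cube, as a seminorm. -/
noncomputable def l2Seminorm (n : ℕ) {m : ℕ} (N : Seminorm ℝ (Fin m → ℝ)) :
    Seminorm ℝ (Cube n → (Fin m → ℝ)) :=
  Seminorm.of (l2Norm N) (l2Norm_add_le N) fun c f => by rw [l2Norm_smul, Real.norm_eq_abs]

theorem l2Seminorm_apply {n m : ℕ} (N : Seminorm ℝ (Fin m → ℝ)) (f : Cube n → (Fin m → ℝ)) :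
    l2Seminorm n N f = l2Norm N f := rfl

/-- A linear functional dominated by a seminorm and norming at a given vector. -/
theorem Seminorm.exists_linear_functional {E : Type*} [AddCommGroup E] [Module ℝ E]
    (P : Seminorm ℝ E) (v : E) :
    ∃ φ : E →ₗ[ℝ] ℝ, φ v = P v ∧ ∀ x, |φ x| ≤ P x := by
  obtain ⟨φ, hφ, hle⟩ : ∃ φ : E →ₗ[ℝ] ℝ, φ v = P v ∧ ∀ x, φ x ≤ P x := by
    by_cases hv : v = 0
    · exact ⟨0, by simp [hv], fun x => apply_nonneg P x⟩
    · obtain ⟨g, hg, hle⟩ := exists_extension_of_le_sublinear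
        (LinearPMap.mkSpanSingleton v (P v) hv) P
        (fun c hc x => by rw [map_smul_eq_mul, Real.norm_of_nonneg hc.le])
        (map_add_le_add P) (by
          rintro ⟨x, hx⟩
          obtain ⟨c, rfl⟩ := Submodule.mem_span_singleton.1 hx
          have h1 := LinearPMap.mkSpanSingleton'_apply v (P v)
            (fun c hc => by simp [(smul_eq_zero.1 hc).resolve_right hv]) c hx
          refine h1.le.trans ?_
          change c • P v ≤ P (c • v)
          rw [map_smul_eq_mul, smul_eq_mul]
          exact mul_le_mul_of_nonneg_right (Real.le_norm_self c) (apply_nonneg P v))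
      refine ⟨g, ?_, hle⟩
      have := hg ⟨v, Submodule.mem_span_singleton_self v⟩
      rw [this]
      exact LinearPMap.mkSpanSingleton_apply ℝ ..
  refine ⟨φ, hφ, fun x => abs_le.2 ⟨?_, hle x⟩⟩
  have := hle (-x)
  rw [map_neg, map_neg_eq_map] at this
  linarith

/-! ### Level multipliers and the noise operator -/

/-- The Fourier multiplier acting by `s k` on the `k`-th homogeneous part. -/
noncomputable def levelMultiplier {n m : ℕ} (s : ℕ → ℝ) (f : Cube n → (Fin m → ℝ)) :
    Cube n → (Fin m → ℝ) :=
  ∑ k ∈ Finset.range (n + 1), s k • levelPart k f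

theorem levelMultiplier_apply {n m : ℕ} (s : ℕ → ℝ) (f : Cube n → (Fin m → ℝ)) (x : Cube n) :
    levelMultiplier s f x = ∑ S : Finset (Fin n), (s S.card * chi S x) • cubeCoeff f S := by
  have hmaps : ∀ S ∈ (Finset.univ : Finset (Finset (Fin n))), S.card ∈ Finset.range (n + 1) :=
    fun S _ => Finset.mem_range.2 (Nat.lt_succ_of_le (by simpa using S.card_le_univ))
  rw [← Finset.sum_fiberwise_of_maps_to hmaps, levelMultiplier, Finset.sum_apply]
  refine Finset.sum_congr rfl fun k _ => ?_
  rw [Pi.smul_apply, levelPart, Finset.smul_sum]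
  refine Finset.sum_congr rfl fun S hS => ?_
  rw [smul_smul, (Finset.mem_filter.1 hS).2]

/-- The kernel of the noise operator. -/
noncomputable def noiseKernel {n : ℕ} (ρ : ℝ) (x y : Cube n) : ℝ :=
  ∏ j, (1 + ρ * (((x j : ℤ) : ℝ) * ((y j : ℤ) : ℝ)))

theorem noiseKernel_eq_sum {n : ℕ} (ρ : ℝ) (x y : Cube n) :
    noiseKernel ρ x y = ∑ S : Finset (Fin n), ρ ^ S.card * (chi S x * chi S y) := by
  rw [noiseKernel, Finset.prod_one_add, Finset.powerset_univ]
  refine Finset.sum_congr rfl fun S _ => ?_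
  simp [chi, Finset.prod_mul_distrib]

theorem noiseKernel_nonneg {n : ℕ} {ρ : ℝ} (hρ : |ρ| ≤ 1) (x y : Cube n) :
    0 ≤ noiseKernel ρ x y := by
  obtain ⟨h1, h2⟩ := abs_le.1 hρ
  refine Finset.prod_nonneg fun j _ => ?_
  rcases Int.units_eq_one_or (x j) with h | h <;>
    rcases Int.units_eq_one_or (y j) with h' | h' <;> simp [h, h'] <;> linarith

theorem noiseKernel_comm {n : ℕ} (ρ : ℝ) (x y : Cube n) :
    noiseKernel ρ x y = noiseKernel ρ y x := by
  simp only [noiseKernel, mul_comm]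

theorem expect_chi {n : ℕ} (S : Finset (Fin n)) :
    𝔼 x : Cube n, chi S x = if S = ∅ then (1 : ℝ) else 0 := by
  simpa [chi] using expect_chi_mul_chi S ∅

theorem expect_noiseKernel {n : ℕ} (ρ : ℝ) (x : Cube n) :
    𝔼 y : Cube n, noiseKernel ρ x y = 1 := by
  simp_rw [noiseKernel_eq_sum]
  rw [Finset.expect_sum_comm]
  simp_rw [← Finset.mul_expect, expect_chi]
  simp [chi]

theorem levelMultiplier_pow_eq_expect {n m : ℕ} (ρ : ℝ) (f : Cube n → (Fin m → ℝ)) (x : Cube n) :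
    levelMultiplier (fun k => ρ ^ k) f x = 𝔼 y : Cube n, noiseKernel ρ x y • f y := by
  rw [levelMultiplier_apply]
  simp_rw [noiseKernel_eq_sum, Finset.sum_smul]
  rw [Finset.expect_sum_comm]
  refine Finset.sum_congr rfl fun S _ => ?_
  rw [cubeCoeff, Finset.smul_expect]
  refine Finset.expect_congr rfl fun y _ => ?_
  rw [smul_smul, mul_assoc]

/-- Jensen's inequality for the square and a probability weight. -/
theorem sq_expect_mul_le {ι : Type*} [Fintype ι] {K : ι → ℝ} (hK : ∀ i, 0 ≤ K i)
    (hK1 : 𝔼 i, K i = 1) (a : ι → ℝ) : (𝔼 i, K i * a i) ^ 2 ≤ 𝔼 i, K i * a i ^ 2 := by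
  obtain ⟨μ, hμ⟩ : ∃ μ, 𝔼 i, K i * a i = μ := ⟨_, rfl⟩
  have h0 : 0 ≤ 𝔼 i, K i * (a i - μ) ^ 2 :=
    Finset.expect_nonneg fun i _ => mul_nonneg (hK i) (sq_nonneg _)
  have h1 : 𝔼 i, K i * (a i - μ) ^ 2
      = (𝔼 i, K i * a i ^ 2) - (𝔼 i, K i * a i) * (2 * μ) + (𝔼 i, K i) * μ ^ 2 := by
    rw [Finset.expect_mul, Finset.expect_mul, ← Finset.expect_sub_distrib,
      ← Finset.expect_add_distrib]
    exact Finset.expect_congr rfl fun i _ => by ring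
  rw [hμ, hK1] at h1
  rw [hμ]
  linarith

/-- Jensen's inequality for the square of a seminorm and a probability weight. -/
theorem Seminorm.sq_expect_smul_le {ι E : Type*} [Fintype ι] [AddCommGroup E] [Module ℝ E]
    [Module ℚ≥0 E] (N : Seminorm ℝ E) {K : ι → ℝ} (hK : ∀ i, 0 ≤ K i) (hK1 : 𝔼 i, K i = 1)
    (v : ι → E) : N (𝔼 i, K i • v i) ^ 2 ≤ 𝔼 i, K i * N (v i) ^ 2 := by
  have h : N (𝔼 i, K i • v i) ≤ 𝔼 i, K i * N (v i) := by
    refine (Finset.le_expect_of_subadditive (map_zero N) (map_add_le_add N) fun q x => ?_).trans_eq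
      (Finset.expect_congr rfl fun i _ => ?_)
    · rw [← NNRat.cast_smul_eq_nnqsmul ℝ, map_smul_eq_mul, ← NNRat.cast_smul_eq_nnqsmul ℝ,
        smul_eq_mul, Real.norm_of_nonneg (by positivity)]
    · rw [map_smul_eq_mul, Real.norm_of_nonneg (hK i)]
  exact (pow_le_pow_left₀ (apply_nonneg N _) h 2).trans (sq_expect_mul_le hK hK1 _)

/-- Noise averages `f` against a nonnegative kernel of mean one: apply Jensen pointwise, then
integrate out `x` by symmetry of the kernel. -/
theorem l2Norm_noise_le {n m : ℕ} (N : Seminorm ℝ (Fin m → ℝ)) {ρ : ℝ} (hρ : |ρ| ≤ 1)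
    (f : Cube n → (Fin m → ℝ)) : l2Norm N (levelMultiplier (fun k => ρ ^ k) f) ≤ l2Norm N f := by
  refine Real.sqrt_le_sqrt ?_
  calc 𝔼 x : Cube n, N (levelMultiplier (fun k => ρ ^ k) f x) ^ 2
      ≤ 𝔼 x : Cube n, 𝔼 y : Cube n, noiseKernel ρ x y * N (f y) ^ 2 := by
        refine Finset.expect_le_expect fun x _ => ?_
        rw [levelMultiplier_pow_eq_expect]
        exact N.sq_expect_smul_le (noiseKernel_nonneg hρ x) (expect_noiseKernel ρ x) f
    _ = 𝔼 y : Cube n, N (f y) ^ 2 := by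
        rw [Finset.expect_comm]
        refine Finset.expect_congr rfl fun y _ => ?_
        rw [← Finset.expect_mul]
        simp_rw [fun x => noiseKernel_comm ρ x y, expect_noiseKernel, one_mul]

/-! ### Auerbach bases -/

theorem Seminorm.continuous_pi_fin {m : ℕ} (N : Seminorm ℝ (Fin m → ℝ)) : Continuous N :=
  continuousOn_univ.1 (N.convexOn.continuousOn isOpen_univ)

theorem Seminorm.exists_pos_mul_norm_le {m : ℕ} (hm : 0 < m) (N : Seminorm ℝ (Fin m → ℝ))
    (hN : ∀ v, N v = 0 → v = 0) : ∃ c > 0, ∀ v, c * ‖v‖ ≤ N v := by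
  have : Nonempty (Fin m) := ⟨⟨0, hm⟩⟩
  obtain ⟨u, hu, hmin⟩ := (isCompact_sphere (0 : Fin m → ℝ) 1).exists_isMinOn
    (NormedSpace.sphere_nonempty.2 zero_le_one) N.continuous_pi_fin.continuousOn
  have hu1 : ‖u‖ = 1 := by simpa using hu
  refine ⟨N u, (apply_nonneg N u).lt_of_ne fun h => ?_, fun v => ?_⟩
  · rw [hN u h.symm, norm_zero] at hu1
    exact zero_ne_one hu1
  · by_cases hv : v = 0
    · simp [hv]
    have hvpos : 0 < ‖v‖ := norm_pos_iff.2 hv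
    have := hmin (a := ‖v‖⁻¹ • v) (by simp [norm_smul, hvpos.ne'])
    simp only [Set.mem_ofPred_eq, map_smul_eq_mul, norm_inv, norm_norm] at this
    rwa [← div_eq_inv_mul, le_div_iff₀ hvpos] at this

/-- Auerbach's lemma: a norm on `ℝ^m` has a basis of vectors of norm at most `1` whose coordinate
functionals have dual norm at most `1`. -/
theorem Seminorm.exists_auerbach {m : ℕ} (hm : 0 < m) (N : Seminorm ℝ (Fin m → ℝ))
    (hN : ∀ v, N v = 0 → v = 0) :
    ∃ (e : Fin m → Fin m → ℝ) (φ : Fin m → (Fin m → ℝ) →ₗ[ℝ] ℝ),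
      (∀ i, N (e i) ≤ 1) ∧ (∀ i v, |φ i v| ≤ N v) ∧ ∀ v, ∑ i, φ i v • e i = v := by
  obtain ⟨c, hc, hcN⟩ := N.exists_pos_mul_norm_le hm hN
  have hNc := N.continuous_pi_fin
  set K : Set (Fin m → Fin m → ℝ) := {M | ∀ i, N (M i) ≤ 1} with hKdef
  have hKclosed : IsClosed K := by
    rw [hKdef, Set.ofPred_forall]
    exact isClosed_iInter fun i =>
      isClosed_le (hNc.comp (continuous_apply i)) continuous_const
  have hKbdd : Bornology.IsBounded K := by
    refine isBounded_iff_forall_norm_le.2 ⟨c⁻¹, fun M hM => ?_⟩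
    refine (pi_norm_le_iff_of_nonneg (by positivity)).2 fun i => ?_
    rw [← one_div, le_div_iff₀ hc, mul_comm]
    exact (hcN _).trans (hM i)
  have hKcomp : IsCompact K := Metric.isCompact_of_isClosed_isBounded hKclosed hKbdd
  have hdet : Continuous fun M : Fin m → Fin m → ℝ => Matrix.det (Matrix.of M) :=
    Continuous.matrix_det continuous_id
  -- The basis maximises the determinant over rows in the unit ball; its coordinate functionals come
  -- from Cramer's rule.
  obtain ⟨M, hM, hmax⟩ := hKcomp.exists_isMaxOn ⟨0, fun i => by simp⟩ hdet.continuousOn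
  have hmax : ∀ M' ∈ K, Matrix.det (Matrix.of M') ≤ Matrix.det (Matrix.of M) := fun M' h => hmax h
  have hpos : 0 < Matrix.det (Matrix.of M) := by
    obtain ⟨B, hB⟩ := (Set.finite_range fun i : Fin m => N (Pi.single i 1)).bddAbove
    have hB' : ∀ i, N (Pi.single i 1) ≤ max B 1 := fun i =>
      (hB (Set.mem_range_self i)).trans (le_max_left _ _)
    have hBpos : 0 < max B 1 := lt_max_of_lt_right one_pos
    -- A small multiple of the identity matrix is admissible, so the maximum is positive.
    have h := hmax (fun i => (max B 1)⁻¹ • Pi.single i 1) fun i => by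
      rw [map_smul_eq_mul, norm_inv, Real.norm_of_nonneg hBpos.le, inv_mul_le_iff₀ hBpos, mul_one]
      exact hB' i
    have he : Matrix.of (fun i : Fin m => (max B 1)⁻¹ • (Pi.single i 1 : Fin m → ℝ))
        = (max B 1)⁻¹ • (1 : Matrix (Fin m) (Fin m) ℝ) := by
      ext i j
      simp [Matrix.one_apply, Pi.single_apply, eq_comm]
    rw [he, Matrix.det_smul, Matrix.det_one, mul_one] at h
    exact lt_of_lt_of_le (by positivity) h
  set d := Matrix.det (Matrix.of M) with hd
  -- Replacing one row by a unit-ball vector stays admissible and cannot increase the determinant.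
  have hupd : ∀ i v, N v ≤ 1 → Matrix.cramer (Matrix.of M).transpose v i ≤ d := by
    intro i v hv
    rw [Matrix.cramer_transpose_apply]
    refine hmax (Function.update M i v) fun j => ?_
    by_cases h : j = i
    · subst h; simpa using hv
    · simpa [h] using hM j
  have hle : ∀ i v, Matrix.cramer (Matrix.of M).transpose v i ≤ d * N v := by
    intro i v
    by_cases hv : v = 0
    · simp [hv]
    have hNv : 0 < N v := (apply_nonneg N v).lt_of_ne fun h => hv (hN v h.symm)
    have := hupd i ((N v)⁻¹ • v) (by
      rw [map_smul_eq_mul, norm_inv, Real.norm_of_nonneg hNv.le, inv_mul_cancel₀ hNv.ne'])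
    rw [map_smul, Pi.smul_apply, smul_eq_mul, inv_mul_le_iff₀ hNv] at this
    linarith
  refine ⟨M, fun i => d⁻¹ • (LinearMap.proj i ∘ₗ Matrix.cramer (Matrix.of M).transpose), hM,
    fun i v => ?_, fun v => ?_⟩
  · simp only [LinearMap.smul_apply, LinearMap.comp_apply, LinearMap.proj_apply, smul_eq_mul]
    rw [abs_mul, abs_inv, abs_of_pos hpos, inv_mul_le_iff₀ hpos]
    refine abs_le.2 ⟨?_, hle i v⟩
    have := hle i (-v)
    rw [map_neg, map_neg_eq_map, Pi.neg_apply] at this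
    linarith
  · have h := Matrix.mulVec_cramer (Matrix.of M).transpose v
    rw [Matrix.det_transpose, ← hd] at h
    have h' : ∑ i, Matrix.cramer (Matrix.of M).transpose v i • M i = d • v := by
      rw [← h]
      ext j
      simp [Matrix.mulVec, dotProduct, mul_comm]
    simp only [LinearMap.smul_apply, LinearMap.comp_apply, LinearMap.proj_apply, smul_assoc]
    rw [← Finset.smul_sum, h', smul_smul, inv_mul_cancel₀ hpos.ne', one_smul]

/-! ### Bounded level multipliers cost a factor `m` -/

/-- Parseval's identity on the cube. -/
theorem expect_sq_sum_chi {n : ℕ} (c : Finset (Fin n) → ℝ) :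
    𝔼 x : Cube n, (∑ S, chi S x * c S) ^ 2 = ∑ S, c S ^ 2 := by
  have : ∀ x : Cube n, (∑ S, chi S x * c S) ^ 2
      = ∑ S, ∑ T, (chi S x * chi T x) * (c S * c T) := fun x => by
    rw [sq, Finset.sum_mul_sum]
    exact Finset.sum_congr rfl fun S _ => Finset.sum_congr rfl fun T _ => by ring
  simp_rw [this]
  rw [Finset.expect_sum_comm]
  simp_rw [Finset.expect_sum_comm, ← Finset.expect_mul, expect_chi_mul_chi]
  simp [sq]

theorem expect_sq_levelMultiplier_le {n m : ℕ} {s : ℕ → ℝ} (hs : ∀ k, |s k| ≤ 1)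
    (φ : (Fin m → ℝ) →ₗ[ℝ] ℝ) (f : Cube n → (Fin m → ℝ)) :
    𝔼 x : Cube n, φ (levelMultiplier s f x) ^ 2 ≤ 𝔼 x : Cube n, φ (f x) ^ 2 := by
  have h1 : ∀ x, φ (levelMultiplier s f x)
      = ∑ S, chi S x * (s S.card * φ (cubeCoeff f S)) := fun x => by
    rw [levelMultiplier_apply, map_sum]
    exact Finset.sum_congr rfl fun S _ => by rw [map_smul, smul_eq_mul]; ring
  have h2 : ∀ x, φ (f x) = ∑ S, chi S x * φ (cubeCoeff f S) := fun x => by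
    conv_lhs => rw [← sum_cubeCoeff f x, map_sum]
    exact Finset.sum_congr rfl fun S _ => by rw [map_smul, smul_eq_mul]
  simp_rw [h1, h2, expect_sq_sum_chi, mul_pow]
  refine Finset.sum_le_sum fun S _ => mul_le_of_le_one_left (sq_nonneg _) ?_
  rw [← sq_abs]
  exact pow_le_one₀ (abs_nonneg _) (hs _)

/-- Each of the `m` Auerbach coordinates is a scalar function, for which Parseval gives a
contraction; the triangle inequality adds them up. -/
theorem l2Norm_levelMultiplier_le {n m : ℕ} (hm : 0 < m) (N : Seminorm ℝ (Fin m → ℝ))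
    (hN : ∀ v, N v = 0 → v = 0) {s : ℕ → ℝ} (hs : ∀ k, |s k| ≤ 1) (f : Cube n → (Fin m → ℝ)) :
    l2Norm N (levelMultiplier s f) ≤ m * l2Norm N f := by
  obtain ⟨e, φ, he, hφ, hsum⟩ := N.exists_auerbach hm hN
  have hdecomp : levelMultiplier s f = ∑ i, fun x => φ i (levelMultiplier s f x) • e i := by
    ext1 x
    rw [Finset.sum_apply, hsum]
  have hi : ∀ i, l2Norm N (fun x => φ i (levelMultiplier s f x) • e i) ≤ l2Norm N f := fun i => by
    refine Real.sqrt_le_sqrt ?_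
    calc 𝔼 x : Cube n, N (φ i (levelMultiplier s f x) • e i) ^ 2
        ≤ 𝔼 x : Cube n, φ i (levelMultiplier s f x) ^ 2 := by
          refine Finset.expect_le_expect fun x _ => ?_
          rw [map_smul_eq_mul, mul_pow, Real.norm_eq_abs, sq_abs]
          exact mul_le_of_le_one_right (sq_nonneg _) (pow_le_one₀ (apply_nonneg N _) (he i))
      _ ≤ 𝔼 x : Cube n, φ i (f x) ^ 2 := expect_sq_levelMultiplier_le hs (φ i) f
      _ ≤ 𝔼 x : Cube n, N (f x) ^ 2 := by
          refine Finset.expect_le_expect fun x _ => ?_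
          rw [← sq_abs]
          exact pow_le_pow_left₀ (abs_nonneg _) (hφ i _) 2
  calc l2Norm N (levelMultiplier s f)
      = l2Seminorm n N (∑ i, fun x => φ i (levelMultiplier s f x) • e i) := by
        rw [← hdecomp, l2Seminorm_apply]
    _ ≤ ∑ i, l2Norm N (fun x => φ i (levelMultiplier s f x) • e i) :=
        Finset.le_sum_of_subadditive (l2Seminorm n N) (map_zero _).le (map_add_le_add _) _ _
    _ ≤ ∑ _i : Fin m, l2Norm N f := Finset.sum_le_sum fun i _ => hi i
    _ = m * l2Norm N f := by simp

/-! ### Choice of `y` and conclusion -/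

theorem Real.cosh_one_le_two : Real.cosh 1 ≤ 2 := by
  have h1 := Real.exp_one_lt_d9
  have h2 : Real.exp (-1) ≤ 1 := Real.exp_le_one_iff.2 (by norm_num)
  rw [Real.cosh_eq]
  linarith

theorem levelPart_eq_zero_of_lt {n m ℓ : ℕ} (h : n < ℓ) (f : Cube n → (Fin m → ℝ)) :
    levelPart ℓ f = 0 := by
  ext1 x
  refine Finset.sum_eq_zero fun S hS => ?_
  have h1 : S.card ≤ n := by simpa using S.card_le_univ
  exact absurd (Finset.mem_filter.1 hS).2 (by omega)

/-- The two coefficient bounds, from the unit disc and from the strip, combine to the final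
constant. -/
theorem le_of_coeff_bounds {ℓ m : ℕ} (hℓ : 0 < ℓ) (hm : 0 < m) {a C : ℝ} (hC : 0 ≤ C)
    (h1 : a ≤ m * C)
    (h2 : ∀ y : ℝ, 0 < y → y ≤ 1 →
      a ≤ C * Real.exp (y * Real.log m) / (y / Real.cosh 1) ^ ℓ) :
    a ≤ (4 + 6 * Real.log ((m : ℝ) + 1) / (ℓ : ℝ)) ^ ℓ * C := by
  have hℓ' : (0 : ℝ) < ℓ := by exact_mod_cast hℓ
  have hm' : (1 : ℝ) ≤ m := by exact_mod_cast hm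
  have hL : 0 ≤ Real.log m := Real.log_nonneg hm'
  have hLL : Real.log m ≤ Real.log ((m : ℝ) + 1) := Real.log_le_log (by linarith) (by linarith)
  have he := Real.exp_one_lt_d9
  -- If `log m < ℓ`, the disc bound suffices, as `m ≤ e^ℓ ≤ 4^ℓ`. Otherwise `y = ℓ / log m ≤ 1`
  -- minimises `m^y / y^ℓ`, and `e * cosh 1 ≤ 6` supplies the other constant.
  rcases lt_or_ge (Real.log m) ℓ with hlt | hge
  · refine h1.trans (mul_le_mul_of_nonneg_right ?_ hC)
    calc (m : ℝ) = Real.exp (Real.log m) := (Real.exp_log (by linarith)).symm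
      _ ≤ Real.exp (ℓ * 1) := Real.exp_le_exp.2 (by linarith)
      _ = Real.exp 1 ^ ℓ := Real.exp_nat_mul _ _
      _ ≤ _ := by
        refine pow_le_pow_left₀ (Real.exp_nonneg _) ?_ ℓ
        have : 0 ≤ 6 * Real.log ((m : ℝ) + 1) / ℓ := by
          have := hL.trans hLL
          positivity
        linarith
  · have hLpos : 0 < Real.log m := hℓ'.trans_le hge
    have hcosh := Real.cosh_pos 1
    refine (h2 (ℓ / Real.log m) (by positivity) ((div_le_one hLpos).2 hge)).trans ?_
    have heq : C * Real.exp (ℓ / Real.log m * Real.log m) / (ℓ / Real.log m / Real.cosh 1) ^ ℓ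
        = (Real.exp 1 * Real.cosh 1 * (Real.log m / ℓ)) ^ ℓ * C := by
      rw [div_mul_cancel₀ _ hLpos.ne', ← mul_one (ℓ : ℝ), Real.exp_nat_mul, mul_one, mul_div_assoc,
        ← div_pow, mul_comm]
      congr 2
      field_simp
    rw [heq]
    refine mul_le_mul_of_nonneg_right (pow_le_pow_left₀ (by positivity) ?_ ℓ) hC
    have h6 : Real.exp 1 * Real.cosh 1 ≤ 6 := by
      nlinarith [Real.cosh_one_le_two, Real.exp_pos 1]
    calc Real.exp 1 * Real.cosh 1 * (Real.log m / ℓ)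
        ≤ 6 * (Real.log ((m : ℝ) + 1) / ℓ) := by gcongr
      _ ≤ 4 + 6 * Real.log ((m : ℝ) + 1) / ℓ := by rw [mul_div_assoc]; linarith

theorem theorem3 (ℓ m n : ℕ) (hℓ : 0 < ℓ) (hm : 0 < m) (hn : 0 < n)
    (N : Seminorm ℝ (Fin m → ℝ)) (hN : ∀ v : Fin m → ℝ, N v = 0 → v = 0)
    (f : Cube n → (Fin m → ℝ)) :
    l2Norm N (levelPart ℓ f) ≤ (4 + 6 * Real.log ((m : ℝ) + 1) / (ℓ : ℝ)) ^ ℓ * l2Norm N f := by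
  have hC := l2Norm_nonneg N f
  have hm1 : (1 : ℝ) ≤ m := by exact_mod_cast hm
  obtain ⟨φ, hφℓ, hφ⟩ := (l2Seminorm n N).exists_linear_functional (levelPart ℓ f)
  simp only [l2Seminorm_apply] at hφℓ hφ
  have hmult : ∀ s : ℕ → ℝ, φ (levelMultiplier s f)
      = ∑ k ∈ Finset.range (n + 1), s k * φ (levelPart k f) := fun s => by
    simp [levelMultiplier, map_sum]
  set p : Polynomial ℂ := ∑ k ∈ Finset.range (n + 1),
    Polynomial.monomial k ((φ (levelPart k f) : ℝ) : ℂ) with hp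
  have heval : ∀ z : ℂ, p.eval z
      = ∑ k ∈ Finset.range (n + 1), ((φ (levelPart k f) : ℝ) : ℂ) * z ^ k := fun z => by
    simp [hp, Polynomial.eval_finsetSum]
  have hsum : ∑ k ∈ Finset.range (n + 1), |φ (levelPart k f)| ≤ m * l2Norm N f := by
    -- The multiplier `s k = sign φ(f_k)` turns `φ` of the multiplied function into the sum of
    -- absolute values.
    have hs : ∀ k, |(SignType.sign (φ (levelPart k f)) : ℝ)| ≤ 1 := fun k => by
      rcases SignType.sign (φ (levelPart k f)) with _ | _ | _ <;> simp
    have h := (le_abs_self _).trans ((hφ _).trans (l2Norm_levelMultiplier_le hm N hN hs f))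
    rw [hmult] at h
    simpa [sign_mul_self] using h
  have hreal : ∀ x : ℝ, |x| ≤ 1 → ‖p.eval (x : ℂ)‖ ≤ l2Norm N f := fun x hx => by
    have h : p.eval (x : ℂ) = ((φ (levelMultiplier (fun k => x ^ k) f) : ℝ) : ℂ) := by
      rw [heval, hmult]
      push_cast
      exact Finset.sum_congr rfl fun k _ => mul_comm _ _
    rw [h, Complex.norm_real, Real.norm_eq_abs]
    exact (hφ _).trans (l2Norm_noise_le N hx f)
  have hdisc : ∀ z : ℂ, ‖z‖ ≤ 1 → ‖p.eval z‖ ≤ m * l2Norm N f := fun z hz => by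
    rw [heval]
    refine (norm_sum_le _ _).trans ((Finset.sum_le_sum fun k _ => ?_).trans hsum)
    rw [norm_mul, Complex.norm_real, Real.norm_eq_abs, norm_pow]
    exact mul_le_of_le_one_right (abs_nonneg _) (pow_le_one₀ (norm_nonneg _) hz)
  have hcoeff : p.coeff ℓ = ((l2Norm N (levelPart ℓ f) : ℝ) : ℂ) := by
    rw [← hφℓ, hp, Polynomial.finsetSum_coeff]
    simp only [Polynomial.coeff_monomial, Finset.sum_ite_eq', Finset.mem_range]
    split_ifs with h
    · rfl
    · rw [levelPart_eq_zero_of_lt (by omega), map_zero, Complex.ofReal_zero]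
  have hnorm : ‖p.coeff ℓ‖ = l2Norm N (levelPart ℓ f) := by
    rw [hcoeff, Complex.norm_real, Real.norm_of_nonneg (l2Norm_nonneg N _)]
  refine le_of_coeff_bounds hℓ hm hC ?_ fun y hy0 hy1 => ?_
  · rcases le_or_gt ℓ n with h | h
    · refine (hφℓ.symm.le.trans (le_abs_self _)).trans (le_trans ?_ hsum)
      exact Finset.single_le_sum (f := fun k => |φ (levelPart k f)|) (fun _ _ => abs_nonneg _)
        (Finset.mem_range.2 (by omega))
    · rw [← hφℓ, levelPart_eq_zero_of_lt h, map_zero]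
      positivity
  · rw [← hnorm]
    exact norm_coeff_le_of_bounded hm1 hC hreal hdisc hy0 hy1 ℓ
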